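/- Let $d\ge 0$ be an integer and let $$\mathcal{HS}_{d+1}=\{(x_1,\dots,x_{d+1})\in\mathbb Z^{d+1} : x_1+\cdots+x_{d+1}\ge 0\},$$ partially ordered by $u\ge v$ if and only if $u-v\in\mathbb Z_{\ge 0}^{d+1}$. This poset is graded; its $t$-th layer is $L_t=\{x\in\mathbb Z^{d+1} : x_1+\cdots+x_{d+1}=t\}$, for $t\ge 0$. Write $u\lessdot v$ if $v$ covers $u$, and let $\mathfrak p(v)=\{u : u\lessdot v\}$; it has exactly $d+1$ elements when $v\notin L_0$, and is empty when $v\in L_0$. Let $\alpha_1,\dots,\alpha_{d+1},\varepsilon,\sigma_0^2>0$ and $\mu_0\in\mathbb R$. Let $X_0\sim\mathcal N(\mu_0,\sigma_0^2)$ and let $W_{u\to v}\sim\mathcal N(0,1)$, for all pairs $u\lessdot v$ in $\mathcal{HS}_{d+1}$, be random variables such that $X_0$ and all the $W_{u\to v}$ are mutually independent. Put $X_v=X_0$ for every $v\in L_0$ and, for $v\in L_t$ with $t\ge 1$, define recursively $$X_v=\alpha_{|\mathfrak p(v)|}\sum_{u\in\mathfrak p(v)}\bigl(X_u+\varepsilon\,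 W_{u\to v}\bigr)$$ (so only the parameter $\alpha=\alpha_{d+1}$ matters). A window of width $N$ is a set $\bigl([x_1,x_1+N)\times\cdots\times[x_{d+1},x_{d+1}+N)\bigr)\cap\mathcal{HS}_{d+1}$ with $x_1,\dots,x_{d+1}\in\mathbb Z$. We say that local reconstruction with windows of width $N$ is possible if there are windows $\mathcal W_0,\mathcal W_1,\dots$ of width $N$ and a function $c:\mathcal{HS}_{d+1}\to\mathbb R$ such that, for every $t\ge 0$, the restriction of $c$ to $L_t$ is supported on $\mathcal W_t$, and such that the random variables $\zeta_t=\sum_{u\in L_t}c_uX_u$ satisfy $\operatorname{Var}(\zeta_t)>0$ for every $t\ge 0$, while the correlation $$\frac{\operatorname{Cov}(\zeta_t,X_0)}{\sqrt{\operatorname{Var}(\zeta_t)\operatorname{Var}(X_0)}}$$ does not converge to $0$ as $t\to\infty$. Local reconstruction is possible if this holds for some finite $N$; single-vertex reconstruction is possible if this holds for $N=1$. Then, for every $d\ge 0$ and every choice of the parameters $\alpha_1,\dots,\alpha_{d+1},\varepsilon,\mu_0,\sigma_0^2$ as above, local reconstruction is possible if and only if single-vertex reconstruction is possible. -/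

import Mathlib

open MeasureTheory ProbabilityTheory Filter Topology
open scoped NNReal

noncomputable section

namespace Reconstruction

section Model

variable {P : Type*} [PartialOrder P] {Ω : Type*}

/-- The cover relations `u ⋖ v` of the poset `P`; they index the noises `W_{u → v}`. -/
abbrev CoverPair (P : Type*) [PartialOrder P] : Type _ := {e : P × P // e.1 ⋖ e.2}

/-- The law of the inputs of the model: `X₀ ∼ N(μ₀, σ₀²)`, each `W_{u → v} ∼ N(0, 1)`, and all of
these random variables together are mutually independent. -/
structure IsInput [MeasurableSpace Ω] (μ₀ : ℝ) (σ₀sq : ℝ≥0) (X₀ : Ω → ℝ)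
    (W : CoverPair P → Ω → ℝ) (μ : Measure Ω) : Prop where
  law_X₀ : HasLaw X₀ (gaussianReal μ₀ σ₀sq) μ
  law_W : ∀ e, HasLaw (W e) (gaussianReal 0 1) μ
  indep : iIndepFun (fun o : Option (CoverPair P) => o.elim X₀ W) μ

/-- Such inputs exist. -/
theorem exists_isInput (P : Type*) [PartialOrder P] (μ₀ : ℝ) (σ₀sq : ℝ≥0) :
    ∃ (μ : Measure (Option (CoverPair P) → ℝ)) (X₀ : (Option (CoverPair P) → ℝ) → ℝ)
      (W : CoverPair P → (Option (CoverPair P) → ℝ) → ℝ),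
      IsProbabilityMeasure μ ∧ IsInput μ₀ σ₀sq X₀ W μ := by
  let ν : Option (CoverPair P) → Measure ℝ :=
    fun o => o.elim (gaussianReal μ₀ σ₀sq) (fun _ => gaussianReal 0 1)
  have hν : ∀ o, IsProbabilityMeasure (ν o) := by
    rintro (_ | e)
    · show IsProbabilityMeasure (gaussianReal μ₀ σ₀sq)
      infer_instance
    · show IsProbabilityMeasure (gaussianReal 0 1)
      infer_instance
  refine ⟨Measure.infinitePi ν, fun ω => ω none, fun e ω => ω (some e), inferInstance,
    (measurePreserving_eval_infinitePi ν none).hasLaw,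
    fun e => (measurePreserving_eval_infinitePi ν (some e)).hasLaw, ?_⟩
  have h := iIndepFun_infinitePi (P := ν) (X := fun _ x => x) (fun _ => measurable_id)
  convert h using 1
  funext o
  cases o <;> rfl

/-- The model recurrence, run for a given number of steps: `X₀` after zero steps, and
`α_{|𝔭(v)|} ∑_{u ∈ 𝔭(v)} (X_u + ε W_{u → v})` afterwards, where `𝔭(v)` is the set of elements
covered by `v`. -/
def iterate (α : ℕ → ℝ) (ε : ℝ) (X₀ : Ω → ℝ) (W : CoverPair P → Ω → ℝ) : ℕ → P → Ω → ℝ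
  | 0, _ => X₀
  | n + 1, v => fun ω => α {u : P | u ⋖ v}.ncard *
      ∑ᶠ u : {u : P // u ⋖ v}, (iterate α ε X₀ W n u.1 ω + ε * W ⟨(u.1, v), u.2⟩ ω)

variable [GradeMinOrder ℕ P]

/-- The random variable `X_v`. See `X_of_rank_zero` and `X_recurrence`. -/
def X (α : ℕ → ℝ) (ε : ℝ) (X₀ : Ω → ℝ) (W : CoverPair P → Ω → ℝ) (v : P) : Ω → ℝ :=
  iterate α ε X₀ W (grade ℕ v) v

theorem X_of_rank_zero (α : ℕ → ℝ) (ε : ℝ) (X₀ : Ω → ℝ) (W : CoverPair P → Ω → ℝ) (v : P)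
    (hv : grade ℕ v = 0) : X α ε X₀ W v = X₀ := by
  simp [X, hv, iterate]

theorem X_recurrence (α : ℕ → ℝ) (ε : ℝ) (X₀ : Ω → ℝ) (W : CoverPair P → Ω → ℝ) (v : P)
    (hv : 1 ≤ grade ℕ v) (ω : Ω) :
    X α ε X₀ W v ω = α {u : P | u ⋖ v}.ncard *
      ∑ᶠ u : {u : P // u ⋖ v}, (X α ε X₀ W u.1 ω + ε * W ⟨(u.1, v), u.2⟩ ω) := by
  obtain ⟨n, hn⟩ := Nat.exists_eq_add_of_le' hv
  have h : ∀ u : {u : P // u ⋖ v}, grade ℕ u.1 = n := fun u => by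
    have := Order.covBy_iff_add_one_eq.1 (u.2.grade ℕ)
    omega
  simp only [X, h]
  rw [hn]
  rfl

/-- The layer `L_t`: the elements of rank `t`. -/
def layer (P : Type*) [PartialOrder P] [GradeMinOrder ℕ P] (t : ℕ) : Set P := {u | grade ℕ u = t}

/-- The estimator `ζ_t = ∑_{u ∈ L_t} c_u X_u`, for `c` with finite support on each layer. -/
def zeta (α : ℕ → ℝ) (ε : ℝ) (X₀ : Ω → ℝ) (W : CoverPair P → Ω → ℝ) (c : P → ℝ) (t : ℕ) : Ω → ℝ :=
  fun ω => ∑ᶠ u ∈ layer P t, c u * X α ε X₀ W u ω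

end Model

/-- The correlation of two real random variables. -/
def corr {Ω : Type*} [MeasurableSpace Ω] (Y Z : Ω → ℝ) (μ : Measure Ω) : ℝ :=
  covariance Y Z μ / √(variance Y μ * variance Z μ)

section Grid

variable {d : ℕ} {P : Set (Fin (d + 1) → ℤ)}

/-- The window `([x₁, x₁ + N) × ⋯ × [x_{d+1}, x_{d+1} + N)) ∩ P` of width `N` in `P`. -/
def window (P : Set (Fin (d + 1) → ℤ)) (N : ℕ) (x : Fin (d + 1) → ℤ) : Set P :=
  {u | ∀ i, u.1 i ∈ Set.Ico (x i) (x i + N)}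

variable [GradeMinOrder ℕ P] {Ω : Type*} [MeasurableSpace Ω]

/-- Local reconstruction is possible with windows of width `N`: there are windows `𝒲_t` of width
`N` with corners `x t`, and coefficients `c` supported, on each layer `L_t`, on `𝒲_t`, such that
every `ζ_t` has positive variance and the correlation of `ζ_t` and `X₀` does not tend to `0`. -/
def LocalReconstructionOfWidth (N : ℕ) (α : ℕ → ℝ) (ε : ℝ) (X₀ : Ω → ℝ)
    (W : CoverPair P → Ω → ℝ) (μ : Measure Ω) : Prop :=
  ∃ (x : ℕ → Fin (d + 1) → ℤ) (c : P → ℝ),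
    (∀ t, ∀ u ∈ layer P t, c u ≠ 0 → u ∈ window P N (x t)) ∧
    (∀ t, 0 < variance (zeta α ε X₀ W c t) μ) ∧
    ¬ Tendsto (fun t => corr (zeta α ε X₀ W c t) X₀ μ) atTop (𝓝 0)

/-- Local reconstruction is possible. -/
def LocalReconstruction (α : ℕ → ℝ) (ε : ℝ) (X₀ : Ω → ℝ) (W : CoverPair P → Ω → ℝ)
    (μ : Measure Ω) : Prop :=
  ∃ N : ℕ, LocalReconstructionOfWidth N α ε X₀ W μ

/-- Single-vertex reconstruction is possible. -/
def SingleVertexReconstruction (α : ℕ → ℝ) (ε : ℝ) (X₀ : Ω → ℝ) (W : CoverPair P → Ω → ℝ)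
    (μ : Measure Ω) : Prop :=
  LocalReconstructionOfWidth 1 α ε X₀ W μ

end Grid

/-- The half-space `ℋ𝒮_{d+1}`. As a subtype of `Fin (d + 1) → ℤ` it carries the entrywise order. -/
def HS (d : ℕ) : Set (Fin (d + 1) → ℤ) := {x | 0 ≤ ∑ i, x i}

theorem HS_le_iff {d : ℕ} (u v : HS d) : v ≤ u ↔ ∀ i, 0 ≤ (u.1 - v.1) i := by
  simp only [Pi.sub_apply, sub_nonneg]
  exact Iff.rfl

theorem HS_sum_lt {d : ℕ} {u v : HS d} (h : u < v) : ∑ i, u.1 i < ∑ i, v.1 i := by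
  have h' : u.1 < v.1 := h
  obtain ⟨hle, i, hi⟩ := Pi.lt_def.1 h'
  exact Finset.sum_lt_sum (fun i _ => hle i) ⟨i, Finset.mem_univ i, hi⟩

theorem HS_sum_sub_single {d : ℕ} (v : Fin (d + 1) → ℤ) (i : Fin (d + 1)) :
    ∑ j, (v - Pi.single i 1 : Fin (d + 1) → ℤ) j = ∑ j, v j - 1 := by
  simp [Finset.sum_sub_distrib]

/-- The elements covered by `v` are the `v - eᵢ` that lie in the half-space. -/
theorem HS_covBy_iff {d : ℕ} (u v : HS d) : u ⋖ v ↔ ∃ i, u.1 = v.1 - Pi.single i 1 := by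
  constructor
  · intro h
    have h' : u.1 < v.1 := h.1
    obtain ⟨hle, i, hi⟩ := Pi.lt_def.1 h'
    refine ⟨i, ?_⟩
    have hu := u.2
    have hlt := HS_sum_lt h.1
    have hs := HS_sum_sub_single v.1 i
    have hw : v.1 - Pi.single i 1 ∈ HS d := by
      simp only [HS, Set.mem_ofPred_eq] at hu ⊢
      omega
    have hwv : (⟨v.1 - Pi.single i 1, hw⟩ : HS d) < v := by
      show v.1 - Pi.single i 1 < v.1
      refine sub_lt_self _ ?_
      exact Pi.single_pos.2 one_pos
    have huw : u ≤ ⟨v.1 - Pi.single i 1, hw⟩ := by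
      show u.1 ≤ v.1 - Pi.single i 1
      intro j
      rcases eq_or_ne j i with rfl | hj
      · simp only [Pi.sub_apply, Pi.single_eq_same]
        omega
      · simpa [hj] using hle j
    rcases huw.eq_or_lt with he | hl
    · exact congrArg Subtype.val he
    · exact absurd hwv (h.2 hl)
  · rintro ⟨i, hi⟩
    have hs := HS_sum_sub_single v.1 i
    rw [← hi] at hs
    refine ⟨?_, fun w h₁ h₂ => ?_⟩
    · show u.1 < v.1
      rw [hi]
      exact sub_lt_self _ (Pi.single_pos.2 one_pos)
    · have := HS_sum_lt h₁
      have := HS_sum_lt h₂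
      omega

/-- Every element of positive rank covers exactly `d + 1` elements. -/
theorem HS_ncard_covered {d : ℕ} (v : HS d) (hv : 1 ≤ ∑ i, v.1 i) :
    {u : HS d | u ⋖ v}.ncard = d + 1 := by
  have hw : ∀ i, v.1 - Pi.single i 1 ∈ HS d := fun i => by
    have hs := HS_sum_sub_single v.1 i
    simp only [HS, Set.mem_ofPred_eq]
    omega
  let f : Fin (d + 1) → HS d := fun i => ⟨v.1 - Pi.single i 1, hw i⟩
  have hf : Function.Injective f := fun i j h => by
    have h1 : v.1 - Pi.single i 1 = v.1 - Pi.single j 1 := congrArg Subtype.val h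
    by_contra hne
    have h2 := congrFun (sub_right_injective h1) i
    simp [hne] at h2
  have hr : {u : HS d | u ⋖ v} = Set.range f := by
    ext u
    simp only [Set.mem_ofPred_eq, HS_covBy_iff, Set.mem_range]
    exact exists_congr fun i => ⟨fun h => Subtype.ext h.symm, fun h => congrArg Subtype.val h.symm⟩
  rw [hr, ← Set.image_univ, Set.ncard_image_of_injective _ hf, Set.ncard_univ]
  simp

/-- The half-space is graded by the sum of the entries. -/
instance HS_gradeMinOrder (d : ℕ) : GradeMinOrder ℕ (HS d) where
  grade v := (∑ i, v.1 i).toNat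
  grade_strictMono u v h := by
    have := HS_sum_lt h
    have hu : 0 ≤ ∑ i, u.1 i := u.2
    show (∑ i, u.1 i).toNat < (∑ i, v.1 i).toNat
    omega
  covBy_grade u v h := by
    obtain ⟨i, hi⟩ := (HS_covBy_iff u v).1 h
    have hs := HS_sum_sub_single v.1 i
    rw [← hi] at hs
    have hu : 0 ≤ ∑ i, u.1 i := u.2
    rw [Order.covBy_iff_add_one_eq]
    omega
  isMin_grade v h := by
    have hv : 0 ≤ ∑ i, v.1 i := v.2
    suffices h0 : (∑ i, v.1 i).toNat = 0 by rw [h0]; exact isMin_bot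
    by_contra hne
    have hs := HS_sum_sub_single v.1 0
    have hw : v.1 - Pi.single 0 1 ∈ HS d := by
      simp only [HS, Set.mem_ofPred_eq]
      omega
    exact not_isMin_of_lt ((HS_covBy_iff ⟨_, hw⟩ v).2 ⟨0, rfl⟩).1 h

theorem HS_grade {d : ℕ} (v : HS d) : ((grade ℕ v : ℕ) : ℤ) = ∑ i, v.1 i :=
  Int.toNat_of_nonneg v.2

end Reconstruction

end

/-!
Each `X v` is a linear combination of the independent inputs, so a linear combination with
coefficients `A` in the layer `t` is governed by elements of the group algebra of `ℤ^(d+1)`: with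
`γ = (d + 1) α_{d+1}` and `q` the step law of the random walk going down the half-space, its signal
part in the layer `t - k` has coefficients `γ^k q^k * A`. Its covariance with `X₀` therefore depends
only on the total mass `m` of `A` and on `t`, and its variance is `m² γ^(2t) σ₀²` plus a multiple of
`∑ k < t, γ^(2k) ‖q^k * A‖²`, with norms in `ℓ²`.

It remains to bound `m² Var (X v)` by a multiple, depending only on the width of the windows, of the
variance of the linear combination: the correlations with `X₀` are then bounded by a multiple of
those of a vertex. If `|γ| > 1`, the signal dominates the noise of `X v`, as `‖q^k‖ ≤ 1`. If
`|γ| ≤ 1`, note that `A` differs from `m` times the point mass at `v` by a bounded number of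
differences of point masses. These lie in the ideal of the `B` with `∑ k, ‖q^k * B‖² < ∞`: by the
parallelogram identity, for two steps `e`, `e'` of the walk, `‖(δ_e - δ_e') * q^k‖²` is at most a
constant times `‖q^k‖² - ‖q^(k+1)‖²`, which telescopes. So the noise of the linear combination is,
up to an error of the order of its first term, `m²` times the noise of `X v`.
-/

namespace Reconstruction

section NormedSpace

theorem sum_sum_norm_sub_sq {E : Type*} [SeminormedAddCommGroup E] [InnerProductSpace ℝ E]
    {ι : Type*} [Fintype ι] (x : ι → E) :
    ∑ i, ∑ j, ‖x i - x j‖ ^ 2 = 2 * Fintype.card ι * ∑ i, ‖x i‖ ^ 2 - 2 * ‖∑ i, x i‖ ^ 2 := by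
  have norm_sum_sq : ‖∑ i, x i‖ ^ 2 = ∑ i, ∑ j, inner ℝ (x i) (x j) := by
    simp only [← real_inner_self_eq_norm_sq, inner_sum, sum_inner]
    exact Finset.sum_comm
  simp only [norm_sub_sq_real, Finset.sum_add_distrib, Finset.sum_sub_distrib, norm_sum_sq,
    Finset.sum_const, Finset.card_univ, nsmul_eq_mul, ← Finset.mul_sum]
  ring

theorem norm_add_sq_le {E : Type*} [SeminormedAddCommGroup E] (x y : E) :
    ‖x + y‖ ^ 2 ≤ 2 * (‖x‖ ^ 2 + ‖y‖ ^ 2) :=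
  (pow_le_pow_left₀ (norm_nonneg _) (norm_add_le x y) 2).trans add_sq_le

theorem norm_sum_smul_sq_le {E : Type*} [SeminormedAddCommGroup E] [NormedSpace ℝ E] {ι : Type*}
    (s : Finset ι) (c : ι → ℝ) (x : ι → E) :
    ‖∑ i ∈ s, c i • x i‖ ^ 2 ≤ (∑ i ∈ s, c i ^ 2) * ∑ i ∈ s, ‖x i‖ ^ 2 := by
  calc ‖∑ i ∈ s, c i • x i‖ ^ 2 ≤ (∑ i ∈ s, |c i| * ‖x i‖) ^ 2 := by
        gcongr
        exact (norm_sum_le _ _).trans_eq (by simp only [norm_smul, Real.norm_eq_abs])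
    _ ≤ (∑ i ∈ s, |c i| ^ 2) * ∑ i ∈ s, ‖x i‖ ^ 2 := Finset.sum_mul_sq_le_sq_mul_sq s _ _
    _ = (∑ i ∈ s, c i ^ 2) * ∑ i ∈ s, ‖x i‖ ^ 2 := by simp only [sq_abs]

end NormedSpace

section GroupAlgebra

open AddMonoidAlgebra
open scoped lp

variable {G : Type*}

theorem memℓp_two_coeff (A : ℝ[G]) : Memℓp A.coeff 2 :=
  (memℓp_zero A.coeff.hasFiniteSupport).of_exponent_ge zero_le

/-- The embedding of the group algebra into `ℓ²(G)`; it provides `ℝ[G]` with the `ℓ²` norm. -/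
noncomputable def toL2 : ℝ[G] →ₗ[ℝ] ℓ²(G, ℝ) where
  toFun A := ⟨fun u => A.coeff u, memℓp_two_coeff A⟩
  map_add' _ _ := rfl
  map_smul' _ _ := rfl

@[simp]
theorem toL2_apply (A : ℝ[G]) (u : G) : toL2 A u = A.coeff u := rfl

theorem norm_toL2_sq (A : ℝ[G]) : ‖toL2 A‖ ^ 2 = ∑' u, A.coeff u ^ 2 := by
  have h := lp.norm_rpow_eq_tsum (p := 2) (by norm_num) (toL2 A)
  simpa using h

theorem norm_toL2_sq_eq_sum (A : ℝ[G]) :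
    ‖toL2 A‖ ^ 2 = A.coeff.sum fun _ r => r ^ 2 := by
  rw [norm_toL2_sq]
  exact tsum_eq_sum fun u hu => by simp [Finsupp.notMem_support_iff.1 hu]

variable [AddCommGroup G]

theorem norm_toL2_single_mul (z : G) (A : ℝ[G]) : ‖toL2 (single z 1 * A)‖ = ‖toL2 A‖ := by
  rw [← sq_eq_sq₀ (norm_nonneg _) (norm_nonneg _), norm_toL2_sq, norm_toL2_sq]
  simp only [coeff_single_mul_apply, one_mul]
  exact (Equiv.addLeft (-z)).tsum_eq fun u => A.coeff u ^ 2

theorem norm_toL2_one : ‖toL2 (1 : ℝ[G])‖ = 1 := by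
  rw [← sq_eq_sq₀ (norm_nonneg _) zero_le_one, norm_toL2_sq_eq_sum]
  simp [one_def]

variable {ι : Type*} [Fintype ι]

/-- The law of one step of the random walk on `G` whose increment is `g i` for a uniformly random
index `i`. The product of `ℝ[G]` is convolution, so `stepLaw g ^ k` is the law after `k` steps. -/
noncomputable def stepLaw (g : ι → G) : ℝ[G] := (Fintype.card ι : ℝ)⁻¹ • ∑ i, single (g i) 1

variable [Nonempty ι] (g : ι → G)

theorem sum_single_eq_card_smul_stepLaw :
    ∑ i, single (g i) 1 = (Fintype.card ι : ℝ) • stepLaw g := by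
  rw [stepLaw, smul_inv_smul₀ (Nat.cast_ne_zero.2 Fintype.card_ne_zero)]

theorem sum_sum_norm_toL2_sub_mul_sq (A : ℝ[G]) :
    ∑ i, ∑ j, ‖toL2 ((single (g i) 1 - single (g j) 1) * A)‖ ^ 2 =
      2 * Fintype.card ι ^ 2 * (‖toL2 A‖ ^ 2 - ‖toL2 (stepLaw g * A)‖ ^ 2) := by
  have h := sum_sum_norm_sub_sq fun i => toL2 (single (g i) 1 * A)
  rw [← map_sum, ← Finset.sum_mul, sum_single_eq_card_smul_stepLaw, smul_mul_assoc, map_smul,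
    norm_smul] at h
  simp only [← map_sub, ← sub_mul, norm_toL2_single_mul, Finset.sum_const, Finset.card_univ,
    nsmul_eq_mul, Real.norm_natCast] at h
  rw [h]
  ring

theorem norm_toL2_sub_mul_sq_le (i j : ι) (A : ℝ[G]) :
    ‖toL2 ((single (g i) 1 - single (g j) 1) * A)‖ ^ 2 ≤
      2 * Fintype.card ι ^ 2 * (‖toL2 A‖ ^ 2 - ‖toL2 (stepLaw g * A)‖ ^ 2) := by
  rw [← sum_sum_norm_toL2_sub_mul_sq]
  let f (i j : ι) := ‖toL2 ((single (g i) 1 - single (g j) 1) * A)‖ ^ 2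
  have hf : ∀ i j, 0 ≤ f i j := fun i j => sq_nonneg _
  calc f i j ≤ ∑ j, f i j := Finset.single_le_sum (fun j _ => hf i j) (Finset.mem_univ j)
    _ ≤ ∑ i, ∑ j, f i j := Finset.single_le_sum (f := fun i => ∑ j, f i j)
        (fun i _ => Finset.sum_nonneg fun j _ => hf i j) (Finset.mem_univ i)

theorem norm_toL2_stepLaw_mul_le (A : ℝ[G]) : ‖toL2 (stepLaw g * A)‖ ≤ ‖toL2 A‖ := by
  rw [← sq_le_sq₀ (norm_nonneg _) (norm_nonneg _), ← sub_nonneg]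
  refine nonneg_of_mul_nonneg_right (a := 2 * (Fintype.card ι : ℝ) ^ 2) ?_ (by positivity)
  rw [← sum_sum_norm_toL2_sub_mul_sq]
  positivity

theorem norm_toL2_stepLaw_pow_le_one (k : ℕ) : ‖toL2 (stepLaw g ^ k)‖ ≤ 1 := by
  induction k with
  | zero => rw [pow_zero, norm_toL2_one]
  | succ k ih => exact pow_succ' (stepLaw g) k ▸ (norm_toL2_stepLaw_mul_le g _).trans ih

theorem summable_norm_toL2_stepLaw_pow_mul_sub (i j : ι) :
    Summable fun k => ‖toL2 (stepLaw g ^ k * (single (g i) 1 - single (g j) 1))‖ ^ 2 := by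
  refine summable_of_sum_range_le (c := 2 * Fintype.card ι ^ 2) (fun _ => sq_nonneg _) fun t => ?_
  calc ∑ k ∈ Finset.range t, ‖toL2 (stepLaw g ^ k * (single (g i) 1 - single (g j) 1))‖ ^ 2
      ≤ ∑ k ∈ Finset.range t, 2 * Fintype.card ι ^ 2 *
          (‖toL2 (stepLaw g ^ k)‖ ^ 2 - ‖toL2 (stepLaw g ^ (k + 1))‖ ^ 2) :=
        Finset.sum_le_sum fun k _ => by
          rw [mul_comm (stepLaw g ^ k), pow_succ' (stepLaw g)]
          exact norm_toL2_sub_mul_sq_le g i j _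
    _ = 2 * Fintype.card ι ^ 2 * (1 - ‖toL2 (stepLaw g ^ t)‖ ^ 2) := by
        rw [← Finset.mul_sum, Finset.sum_range_sub', pow_zero, norm_toL2_one, one_pow]
    _ ≤ 2 * Fintype.card ι ^ 2 :=
        mul_le_of_le_one_right (by positivity) (sub_le_self _ (sq_nonneg _))

/-- The signed measures `q` on `G` whose convolutions with the laws of the random walk have a
square-summable sequence of `ℓ²` norms. -/
noncomputable def squareSummableIdeal (g : ι → G) : Ideal ℝ[G] where
  carrier := {q | Summable fun k => ‖toL2 (stepLaw g ^ k * q)‖ ^ 2}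
  zero_mem' := by
    simp
  add_mem' {q r} hq hr := by
    refine ((hq.add hr).mul_left 2).of_nonneg_of_le (fun _ => sq_nonneg _) fun k => ?_
    rw [mul_add, map_add]
    exact norm_add_sq_le _ _
  smul_mem' r q hq := by
    simp only [Set.mem_ofPred_eq, smul_eq_mul] at hq ⊢
    induction r using AddMonoidAlgebra.induction_linear with
    | zero => simp
    | add r s hr hs =>
      refine ((hr.add hs).mul_left 2).of_nonneg_of_le (fun _ => sq_nonneg _) fun k => ?_
      rw [add_mul, mul_add, map_add]
      exact norm_add_sq_le _ _
    | single z a =>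
      refine (hq.mul_left (a ^ 2)).congr fun k => ?_
      have hza : single z a = a • single z (1 : ℝ) := by rw [smul_single', mul_one]
      rw [hza, smul_mul_assoc, mul_smul_comm, mul_left_comm, map_smul, norm_smul, mul_pow,
        norm_toL2_single_mul, Real.norm_eq_abs, sq_abs]

theorem single_sub_one_mem_squareSummableIdeal {z : G}
    (hz : z ∈ AddSubgroup.closure (Set.range fun p : ι × ι => g p.1 - g p.2)) :
    single z 1 - 1 ∈ squareSummableIdeal g := by
  induction hz using AddSubgroup.closure_induction with
  | mem z hz =>
    obtain ⟨⟨i, j⟩, rfl⟩ := hz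
    have h := (squareSummableIdeal g).mul_mem_left (single (-g j) 1)
      (summable_norm_toL2_stepLaw_pow_mul_sub g i j)
    simpa [mul_sub, single_mul_single, one_def, neg_add_eq_sub] using h
  | zero => simp [one_def]
  | add z w _ _ hz hw =>
    have h : single (z + w) 1 - 1 = single z (1 : ℝ) * (single w 1 - 1) + (single z 1 - 1) := by
      rw [mul_sub, single_mul_single, mul_one, mul_one, sub_add_sub_cancel]
    exact h ▸ add_mem ((squareSummableIdeal g).mul_mem_left _ hw) hz
  | neg z _ hz =>
    have h : single (-z) 1 - 1 = -single (-z) (1 : ℝ) * (single z 1 - 1) := by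
      rw [neg_mul, mul_sub, single_mul_single, neg_add_cancel, mul_one, mul_one, neg_sub, one_def]
    exact h ▸ (squareSummableIdeal g).mul_mem_left _ hz

theorem sub_single_degree_eq_sum (A : ℝ[G]) (v : G) :
    A - single v A.coeff.degree =
      ∑ u ∈ A.coeff.support, A.coeff u • (single v 1 * (single (u - v) 1 - 1)) := by
  simp only [mul_sub, single_mul_single, add_sub_cancel, mul_one, smul_sub,
    Finset.sum_sub_distrib, smul_single', Finsupp.degree_apply]
  exact congrArg₂ (· - ·) (sum_coeff_single A).symm (map_sum (singleAddHom v) _ _)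

theorem norm_toL2_mul_sub_single_degree_sq_le (q A : ℝ[G]) (v : G) :
    ‖toL2 (q * (A - single v A.coeff.degree))‖ ^ 2 ≤
      ‖toL2 A‖ ^ 2 * ∑ u ∈ A.coeff.support, ‖toL2 (q * (single (u - v) 1 - 1))‖ ^ 2 := by
  rw [sub_single_degree_eq_sum, Finset.mul_sum, map_sum, norm_toL2_sq_eq_sum]
  simp only [mul_smul_comm, map_smul]
  refine (norm_sum_smul_sq_le _ _ _).trans_eq ?_
  simp only [mul_left_comm q, norm_toL2_single_mul, Finsupp.sum]

theorem exists_sum_norm_toL2_stepLaw_pow_mul_sub_single_le {B : Finset G}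
    (hB : ∀ z ∈ B, z ∈ AddSubgroup.closure (Set.range fun p : ι × ι => g p.1 - g p.2)) :
    ∃ K : ℝ, 0 ≤ K ∧ ∀ (A : ℝ[G]) (v : G), (∀ u ∈ A.coeff.support, u - v ∈ B) → ∀ t : ℕ,
      ∑ k ∈ Finset.range t, ‖toL2 (stepLaw g ^ k * (A - single v A.coeff.degree))‖ ^ 2 ≤
        K * ‖toL2 A‖ ^ 2 := by
  classical
  let S (z : G) (k : ℕ) := ‖toL2 (stepLaw g ^ k * (single z 1 - 1))‖ ^ 2
  have hS_nonneg (z : G) (k : ℕ) : 0 ≤ S z k := sq_nonneg _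
  refine ⟨∑ z ∈ B, ∑' k, S z k, Finset.sum_nonneg fun z _ => tsum_nonneg (hS_nonneg z),
    fun A v hA t => ?_⟩
  calc ∑ k ∈ Finset.range t, ‖toL2 (stepLaw g ^ k * (A - single v A.coeff.degree))‖ ^ 2
      ≤ ∑ k ∈ Finset.range t, ‖toL2 A‖ ^ 2 * ∑ u ∈ A.coeff.support, S (u - v) k :=
        Finset.sum_le_sum fun k _ => norm_toL2_mul_sub_single_degree_sq_le _ A v
    _ = (∑ z ∈ A.coeff.support.image (· - v), ∑ k ∈ Finset.range t, S z k) * ‖toL2 A‖ ^ 2 := by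
        rw [← Finset.mul_sum, mul_comm, Finset.sum_comm,
          Finset.sum_image fun u _ w _ h => sub_left_injective h]
    _ ≤ (∑ z ∈ B, ∑' k, S z k) * ‖toL2 A‖ ^ 2 := by
        gcongr
        refine (Finset.sum_le_sum_of_subset_of_nonneg (Finset.image_subset_iff.2 hA)
          fun z _ _ => Finset.sum_nonneg fun k _ => hS_nonneg z k).trans ?_
        exact Finset.sum_le_sum fun z hz =>
          (single_sub_one_mem_squareSummableIdeal g (hB z hz)).sum_le_tsum _
            fun k _ => hS_nonneg z k

theorem degree_sq_mul_norm_toL2_sq_le (q A : ℝ[G]) (v : G) :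
    A.coeff.degree ^ 2 * ‖toL2 q‖ ^ 2 ≤
      2 * (‖toL2 (q * A)‖ ^ 2 + ‖toL2 (q * (A - single v A.coeff.degree))‖ ^ 2) := by
  set m := A.coeff.degree
  have hvm : single v m = m • single v (1 : ℝ) := by rw [smul_single', mul_one]
  calc m ^ 2 * ‖toL2 q‖ ^ 2 = ‖toL2 (q * single v m)‖ ^ 2 := by
        rw [hvm, mul_smul_comm, mul_comm q, map_smul, norm_smul, mul_pow, norm_toL2_single_mul,
          Real.norm_eq_abs, sq_abs]
    _ = ‖toL2 (q * A) + -toL2 (q * (A - single v m))‖ ^ 2 := by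
        rw [← sub_eq_add_neg, ← map_sub, ← mul_sub, sub_sub_cancel]
    _ ≤ 2 * (‖toL2 (q * A)‖ ^ 2 + ‖toL2 (q * (A - single v m))‖ ^ 2) := by
        simpa only [norm_neg] using norm_add_sq_le (toL2 (q * A)) (-toL2 (q * (A - single v m)))

theorem exists_degree_sq_mul_sum_le {B : Finset G}
    (hB : ∀ z ∈ B, z ∈ AddSubgroup.closure (Set.range fun p : ι × ι => g p.1 - g p.2)) :
    ∃ M : ℝ, 1 ≤ M ∧ ∀ {r : ℝ}, 0 ≤ r → r ≤ 1 → ∀ A : ℝ[G],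
      (∀ u ∈ A.coeff.support, ∀ v ∈ A.coeff.support, u - v ∈ B) → ∀ t : ℕ,
      A.coeff.degree ^ 2 * ∑ k ∈ Finset.range t, r ^ k * ‖toL2 (stepLaw g ^ k)‖ ^ 2 ≤
        M * ∑ k ∈ Finset.range t, r ^ k * ‖toL2 (stepLaw g ^ k * A)‖ ^ 2 := by
  obtain ⟨K, hK, h⟩ := exists_sum_norm_toL2_stepLaw_pow_mul_sub_single_le g hB
  refine ⟨2 * (1 + K), by linarith, fun {r} hr hr1 A hA t => ?_⟩
  rcases A.coeff.support.eq_empty_or_nonempty with hA0 | ⟨v, hv⟩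
  · simp [Finsupp.degree_apply, coeff_eq_zero.1 (Finsupp.support_eq_empty.1 hA0)]
  rcases t with _ | t
  · simp
  let V (k : ℕ) := ‖toL2 (stepLaw g ^ k * A)‖ ^ 2
  let D (k : ℕ) := ‖toL2 (stepLaw g ^ k * (A - single v A.coeff.degree))‖ ^ 2
  have initial_le : ‖toL2 A‖ ^ 2 ≤ ∑ k ∈ Finset.range (t + 1), r ^ k * V k := by
    have h := Finset.single_le_sum (f := fun k => r ^ k * V k) (fun k _ => by positivity)
      (Finset.mem_range.2 t.succ_pos)
    simpa [V] using h
  have error_le : ∑ k ∈ Finset.range (t + 1), r ^ k * D k ≤ K * ‖toL2 A‖ ^ 2 :=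
    (Finset.sum_le_sum fun k _ => mul_le_of_le_one_left (sq_nonneg _) (pow_le_one₀ hr hr1)).trans
      (h A v (fun u hu => hA u hu v hv) _)
  calc A.coeff.degree ^ 2 * ∑ k ∈ Finset.range (t + 1), r ^ k * ‖toL2 (stepLaw g ^ k)‖ ^ 2
      ≤ ∑ k ∈ Finset.range (t + 1), r ^ k * (2 * (V k + D k)) := by
        rw [Finset.mul_sum]
        refine Finset.sum_le_sum fun k _ => ?_
        rw [mul_left_comm]
        exact mul_le_mul_of_nonneg_left (degree_sq_mul_norm_toL2_sq_le _ A v) (pow_nonneg hr k)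
    _ = 2 * (∑ k ∈ Finset.range (t + 1), r ^ k * V k +
          ∑ k ∈ Finset.range (t + 1), r ^ k * D k) := by
        rw [← Finset.sum_add_distrib, Finset.mul_sum]
        exact Finset.sum_congr rfl fun k _ => by ring
    _ ≤ 2 * (1 + K) * ∑ k ∈ Finset.range (t + 1), r ^ k * V k := by
        linarith [mul_le_mul_of_nonneg_left initial_le hK]

theorem exists_degree_sq_mul_add_sum_le {B : Finset G}
    (hB : ∀ z ∈ B, z ∈ AddSubgroup.closure (Set.range fun p : ι × ι => g p.1 - g p.2))
    {r κ s : ℝ} (hr : 0 ≤ r) (hκ : 0 ≤ κ) (hs : 0 < s) :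
    ∃ M : ℝ, ∀ A : ℝ[G],
      (∀ u ∈ A.coeff.support, ∀ v ∈ A.coeff.support, u - v ∈ B) → ∀ t : ℕ,
      A.coeff.degree ^ 2 *
          (r ^ t * s + κ * ∑ k ∈ Finset.range t, r ^ k * ‖toL2 (stepLaw g ^ k)‖ ^ 2) ≤
        M * (A.coeff.degree ^ 2 * (r ^ t * s) +
          κ * ∑ k ∈ Finset.range t, r ^ k * ‖toL2 (stepLaw g ^ k * A)‖ ^ 2) := by
  rcases le_or_gt r 1 with hr1 | hr1
  · obtain ⟨M, hM, h⟩ := exists_degree_sq_mul_sum_le g hB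
    refine ⟨M, fun A hA t => ?_⟩
    have hsignal : 0 ≤ A.coeff.degree ^ 2 * (r ^ t * s) := by positivity
    linarith [mul_le_mul_of_nonneg_left (h hr hr1 A hA t) hκ, le_mul_of_one_le_left hsignal hM]
  · have : 0 < r - 1 := sub_pos.2 hr1
    refine ⟨1 + κ / ((r - 1) * s), fun A _ t => ?_⟩
    have geom_le : ∑ k ∈ Finset.range t, r ^ k * ‖toL2 (stepLaw g ^ k)‖ ^ 2 ≤ r ^ t / (r - 1) :=
      calc ∑ k ∈ Finset.range t, r ^ k * ‖toL2 (stepLaw g ^ k)‖ ^ 2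
          ≤ ∑ k ∈ Finset.range t, r ^ k := Finset.sum_le_sum fun k _ =>
            mul_le_of_le_one_right (pow_nonneg hr k)
              (pow_le_one₀ (norm_nonneg _) (norm_toL2_stepLaw_pow_le_one g k))
        _ ≤ r ^ t / (r - 1) := by
            rw [geom_sum_eq hr1.ne']
            gcongr
            exact sub_le_self _ zero_le_one
    calc A.coeff.degree ^ 2 *
          (r ^ t * s + κ * ∑ k ∈ Finset.range t, r ^ k * ‖toL2 (stepLaw g ^ k)‖ ^ 2)
        ≤ A.coeff.degree ^ 2 * (r ^ t * s + κ * (r ^ t / (r - 1))) := by gcongr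
      _ = (1 + κ / ((r - 1) * s)) * (A.coeff.degree ^ 2 * (r ^ t * s)) := by field_simp
      _ ≤ _ := by
          gcongr
          exact le_add_of_nonneg_right (by positivity)

end GroupAlgebra

section Model

variable {P : Type*} [PartialOrder P] {Ω : Type*} {mΩ : MeasurableSpace Ω} {μ : Measure Ω}

section Input

variable {μ₀ : ℝ} {σ₀sq : ℝ≥0} {X₀ : Ω → ℝ} {W : CoverPair P → Ω → ℝ}

theorem memLp_two_of_hasLaw_gaussianReal {Y : Ω → ℝ} {m : ℝ} {v : ℝ≥0}
    (hY : HasLaw Y (gaussianReal m v) μ) : MemLp Y 2 μ := by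
  rw [← Function.id_comp Y, ← memLp_map_measure_iff aestronglyMeasurable_id hY.aemeasurable,
    hY.map_eq]
  exact memLp_id_gaussianReal 2

theorem IsInput.variance_X₀ (h : IsInput μ₀ σ₀sq X₀ W μ) : Var[X₀; μ] = σ₀sq := by
  rw [h.law_X₀.variance_eq, variance_id_gaussianReal]

theorem IsInput.memLp_X₀ (h : IsInput μ₀ σ₀sq X₀ W μ) : MemLp X₀ 2 μ :=
  memLp_two_of_hasLaw_gaussianReal h.law_X₀

theorem IsInput.memLp_W (h : IsInput μ₀ σ₀sq X₀ W μ) (e : CoverPair P) : MemLp (W e) 2 μ :=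
  memLp_two_of_hasLaw_gaussianReal (h.law_W e)

theorem IsInput.covariance_X₀_W (h : IsInput μ₀ σ₀sq X₀ W μ) (e : CoverPair P) :
    cov[X₀, W e; μ] = 0 :=
  (h.indep.indepFun (i := none) (j := some e) (by simp)).covariance_eq_zero h.memLp_X₀ (h.memLp_W e)

theorem IsInput.covariance_W_W (h : IsInput μ₀ σ₀sq X₀ W μ) {e e' : CoverPair P} (he : e ≠ e') :
    cov[W e, W e'; μ] = 0 :=
  (h.indep.indepFun (i := some e) (j := some e') (by simpa using he)).covariance_eq_zero
    (h.memLp_W e) (h.memLp_W e')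

theorem IsInput.covariance_W_self (h : IsInput μ₀ σ₀sq X₀ W μ) (e : CoverPair P) :
    cov[W e, W e; μ] = 1 := by
  rw [covariance_self (h.law_W e).aemeasurable, (h.law_W e).variance_eq, variance_id_gaussianReal,
    NNReal.coe_one]

end Input

variable (α : ℕ → ℝ) (ε : ℝ) (X₀ : Ω → ℝ) (W : CoverPair P → Ω → ℝ)

section LowerCovers

variable [∀ v : P, Fintype {u : P // u ⋖ v}]

/-- The coefficients, in terms of the layer below, of the signal part of a linear combination of
the variables `X v`; see `estimator_eq_add`. -/
noncomputable def descend : (P →₀ ℝ) →ₗ[ℝ] (P →₀ ℝ) :=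
  Finsupp.linearCombination ℝ fun v =>
    α (Fintype.card {u // u ⋖ v}) • ∑ u : {u // u ⋖ v}, Finsupp.single u.1 1

/-- The noise, up to the factor `ε`, that enters the model at the vertex `v`. -/
noncomputable def vertexNoise (v : P) : Ω → ℝ :=
  α (Fintype.card {u // u ⋖ v}) • ∑ u : {u // u ⋖ v}, W ⟨(u.1, v), u.2⟩

/-- The noise, up to the factor `ε`, that enters `∑ v, c v • X v` at the vertices of the support of
the coefficients `c`. -/
noncomputable def noise : (P →₀ ℝ) →ₗ[ℝ] (Ω → ℝ) := Finsupp.linearCombination ℝ (vertexNoise α W)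

/-- The variance of `noise α W c`; see `IsInput.variance_noise`. -/
noncomputable def noisePower (c : P →₀ ℝ) : ℝ :=
  c.sum fun v r =>
    r ^ 2 * (α (Fintype.card {u // u ⋖ v}) ^ 2 * Fintype.card {u // u ⋖ v})

section Noise

variable {α X₀ W} {μ₀ : ℝ} {σ₀sq : ℝ≥0}

theorem IsInput.memLp_vertexNoise (h : IsInput μ₀ σ₀sq X₀ W μ) (v : P) :
    MemLp (vertexNoise α W v) 2 μ :=
  (memLp_finsetSum' _ fun _ _ => h.memLp_W _).const_smul _

theorem IsInput.memLp_noise (h : IsInput μ₀ σ₀sq X₀ W μ) (c : P →₀ ℝ) :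
    MemLp (noise α W c) 2 μ :=
  memLp_finsetSum' _ fun _ _ => (h.memLp_vertexNoise _).const_smul _

variable [IsProbabilityMeasure μ]

theorem IsInput.covariance_vertexNoise_self (h : IsInput μ₀ σ₀sq X₀ W μ) (v : P) :
    cov[vertexNoise α W v, vertexNoise α W v; μ] =
      α (Fintype.card {u // u ⋖ v}) ^ 2 * Fintype.card {u // u ⋖ v} := by
  classical
  have covariance_W (u u' : {u // u ⋖ v}) :
      cov[W ⟨(u.1, v), u.2⟩, W ⟨(u'.1, v), u'.2⟩; μ] = if u = u' then 1 else 0 := by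
    split_ifs with hu
    · exact hu ▸ h.covariance_W_self _
    · exact h.covariance_W_W fun he => hu (Subtype.ext (congrArg (·.1.1) he))
  rw [vertexNoise, covariance_smul_left, covariance_smul_right,
    covariance_sum_sum (fun _ => h.memLp_W _) fun _ => h.memLp_W _]
  simp only [covariance_W, Finset.sum_ite_eq, Finset.mem_univ, if_true, Finset.sum_const,
    Finset.card_univ, nsmul_eq_mul, mul_one]
  ring

theorem IsInput.covariance_vertexNoise_of_ne (h : IsInput μ₀ σ₀sq X₀ W μ) {v w : P} (hvw : v ≠ w) :
    cov[vertexNoise α W v, vertexNoise α W w; μ] = 0 := by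
  rw [vertexNoise, vertexNoise, covariance_smul_left, covariance_smul_right,
    covariance_sum_sum (fun _ => h.memLp_W _) fun _ => h.memLp_W _]
  have covariance_W (u : {u // u ⋖ v}) (u' : {u // u ⋖ w}) :
      cov[W ⟨(u.1, v), u.2⟩, W ⟨(u'.1, w), u'.2⟩; μ] = 0 :=
    h.covariance_W_W fun he => hvw (congrArg (·.1.2) he)
  simp only [covariance_W, Finset.sum_const_zero, mul_zero]

theorem IsInput.variance_noise (h : IsInput μ₀ σ₀sq X₀ W μ) (c : P →₀ ℝ) :
    Var[noise α W c; μ] = noisePower α c := by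
  have noise_eq : noise α W c = ∑ v ∈ c.support, c v • vertexNoise α W v := rfl
  rw [noise_eq, variance_sum' fun v _ => (h.memLp_vertexNoise v).const_smul _]
  refine Finset.sum_congr rfl fun v hv => ?_
  rw [Finset.sum_eq_single_of_mem v hv]
  · rw [covariance_smul_left, covariance_smul_right, h.covariance_vertexNoise_self]
    ring
  · intro w _ hwv
    rw [covariance_smul_left, covariance_smul_right, h.covariance_vertexNoise_of_ne hwv.symm,
      mul_zero, mul_zero]

end Noise

end LowerCovers

variable [GradeMinOrder ℕ P]

theorem grade_of_covBy {t : ℕ} {u v : P} (h : u ⋖ v) (hv : grade ℕ v = t + 1) : grade ℕ u = t :=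
  Nat.succ_injective ((Order.covBy_iff_add_one_eq.1 (h.grade ℕ)).trans hv)

/-- The linear combination `∑ v, c v • X v` of the variables of the model. -/
noncomputable def estimator : (P →₀ ℝ) →ₗ[ℝ] (Ω → ℝ) := Finsupp.linearCombination ℝ (X α ε X₀ W)

theorem estimator_single (v : P) :
    estimator α ε X₀ W (Finsupp.single v 1) = X α ε X₀ W v := by
  rw [estimator, Finsupp.linearCombination_single, one_smul]

theorem estimator_of_layer_zero {c : P →₀ ℝ} (hc : c ∈ Finsupp.supported ℝ ℝ (layer P 0)) :
    estimator α ε X₀ W c = c.degree • X₀ := by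
  rw [Finsupp.degree_apply, Finset.sum_smul]
  exact Finset.sum_congr rfl fun v hv => congrArg (c v • ·) (X_of_rank_zero α ε X₀ W v (hc hv))

theorem exists_zeta_eq_estimator {c : P → ℝ} {t : ℕ}
    (hc : (layer P t ∩ Function.support c).Finite) :
    ∃ a ∈ Finsupp.supported ℝ ℝ (layer P t), (∀ u ∈ a.support, c u ≠ 0) ∧
      zeta α ε X₀ W c t = estimator α ε X₀ W a := by
  refine ⟨Finsupp.indicator hc.toFinset fun u _ => c u, fun u hu => ?_, fun u hu => ?_, ?_⟩
  · exact (hc.mem_toFinset.1 (Finsupp.support_indicator_subset _ _ hu)).1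
  · exact (hc.mem_toFinset.1 (Finsupp.support_indicator_subset _ _ hu)).2
  · ext ω
    rw [estimator, Finsupp.linearCombination_apply, Finsupp.sum_indicator_index _ (by simp),
      Finset.sum_apply]
    refine finsum_mem_eq_sum_of_inter_support_eq _ ?_
    have support_subset : (Function.support fun u => c u * X α ε X₀ W u ω) ⊆ Function.support c :=
      fun _ => left_ne_zero_of_mul
    rw [Set.Finite.coe_toFinset, Set.inter_assoc, Set.inter_eq_self_of_subset_right support_subset]

theorem zeta_indicator_range {v : ℕ → P} (hv : ∀ t, v t ∈ layer P t) (t : ℕ) :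
    zeta α ε X₀ W ((Set.range v).indicator 1) t = X α ε X₀ W (v t) := by
  ext ω
  have eq_zero_of_ne (u : P) (hu : u ≠ v t) :
      ∑ᶠ _ : u ∈ layer P t, (Set.range v).indicator (1 : P → ℝ) u * X α ε X₀ W u ω = 0 := by
    refine (finsum_congr fun hut => ?_).trans finsum_zero
    rw [Set.indicator_of_notMem, zero_mul]
    rintro ⟨s, rfl⟩
    exact hu (congrArg v ((hv s).symm.trans hut))
  refine (finsum_eq_single _ (v t) eq_zero_of_ne).trans ?_
  simp [hv]

/-- The span of the inputs of the model up to the layer `t`. -/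
noncomputable def inputSpan (t : ℕ) : Submodule ℝ (Ω → ℝ) :=
  Submodule.span ℝ (insert X₀ (W '' {e | grade ℕ e.1.2 ≤ t}))

theorem inputSpan_mono : Monotone (inputSpan X₀ W) := fun _ _ hst =>
  Submodule.span_mono (Set.insert_subset_insert (Set.image_mono fun _ he => le_trans he hst))

section InputSpan

variable {X₀ W} {μ₀ : ℝ} {σ₀sq : ℝ≥0}

theorem IsInput.memLp_of_mem_inputSpan (h : IsInput μ₀ σ₀sq X₀ W μ) {t : ℕ} {Y : Ω → ℝ}
    (hY : Y ∈ inputSpan X₀ W t) : MemLp Y 2 μ := by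
  induction hY using Submodule.span_induction with
  | mem Y hY =>
    obtain rfl | ⟨e, -, rfl⟩ := hY
    exacts [h.memLp_X₀, h.memLp_W e]
  | zero => exact MemLp.zero
  | add Y Z _ _ hY hZ => exact hY.add hZ
  | smul r Y _ hY => exact hY.const_smul r

theorem IsInput.covariance_W_of_mem_inputSpan [IsProbabilityMeasure μ]
    (h : IsInput μ₀ σ₀sq X₀ W μ) {t : ℕ} {Y : Ω → ℝ} (hY : Y ∈ inputSpan X₀ W t)
    {e : CoverPair P} (he : t < grade ℕ e.1.2) :
    cov[Y, W e; μ] = 0 := by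
  induction hY using Submodule.span_induction with
  | mem Y hY =>
    obtain rfl | ⟨e', he', rfl⟩ := hY
    · exact h.covariance_X₀_W e
    · exact h.covariance_W_W fun hee => (hee ▸ he').not_gt he
  | zero => exact covariance_zero_left
  | add Y Z hY hZ ihY ihZ =>
    rw [covariance_add_left (h.memLp_of_mem_inputSpan hY) (h.memLp_of_mem_inputSpan hZ)
      (h.memLp_W e), ihY, ihZ, add_zero]
  | smul r Y _ ihY => rw [covariance_smul_left, ihY, mul_zero]

end InputSpan

section Recursion

variable [∀ v : P, Fintype {u : P // u ⋖ v}]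

theorem X_eq_smul_sum {v : P} (hv : 1 ≤ grade ℕ v) :
    X α ε X₀ W v = α (Fintype.card {u // u ⋖ v}) •
      ∑ u : {u // u ⋖ v}, (X α ε X₀ W u.1 + ε • W ⟨(u.1, v), u.2⟩) := by
  ext ω
  have ncard_eq : {u : P | u ⋖ v}.ncard = Fintype.card {u // u ⋖ v} :=
    (Nat.card_coe_set_eq _).symm.trans (Nat.card_eq_fintype_card (α := {u // u ⋖ v}))
  rw [X_recurrence α ε X₀ W v hv, finsum_eq_sum_of_fintype, ncard_eq]
  simp

theorem estimator_eq_add {t : ℕ} {c : P →₀ ℝ} (hc : c ∈ Finsupp.supported ℝ ℝ (layer P (t + 1))) :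
    estimator α ε X₀ W c = estimator α ε X₀ W (descend α c) + ε • noise α W c := by
  rw [Finsupp.supported_eq_span_single] at hc
  refine LinearMap.eqOn_span (g := estimator α ε X₀ W ∘ₗ descend α + ε • noise α W) ?_ hc
  rintro _ ⟨v, hv, rfl⟩
  have hv : 1 ≤ grade ℕ v := le_of_le_of_eq t.succ_pos (Eq.symm hv)
  simp only [estimator, descend, noise, vertexNoise, LinearMap.add_apply, LinearMap.smul_apply,
    LinearMap.comp_apply, Finsupp.linearCombination_single, map_smul, map_sum, one_smul,
    X_eq_smul_sum α ε X₀ W hv, Finset.sum_add_distrib, Finset.smul_sum, smul_add]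
  simp only [smul_comm ε]

theorem descend_mem_supported {t : ℕ} {c : P →₀ ℝ}
    (hc : c ∈ Finsupp.supported ℝ ℝ (layer P (t + 1))) :
    descend α c ∈ Finsupp.supported ℝ ℝ (layer P t) :=
  Submodule.sum_mem _ fun _ hv => Submodule.smul_mem _ _ <| Submodule.smul_mem _ _ <|
    Submodule.sum_mem _ fun u _ => Finsupp.single_mem_supported ℝ 1 (grade_of_covBy u.2 (hc hv))

theorem descend_pow_mem_supported {k t : ℕ} {c : P →₀ ℝ}
    (hc : c ∈ Finsupp.supported ℝ ℝ (layer P (t + k))) :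
    (descend α ^ k) c ∈ Finsupp.supported ℝ ℝ (layer P t) := by
  induction k generalizing c with
  | zero => exact hc
  | succ k ih => exact ih (descend_mem_supported α hc)

end Recursion

section Finite

variable [∀ v : P, Finite {u : P // u ⋖ v}]

theorem X_mem_inputSpan (v : P) : X α ε X₀ W v ∈ inputSpan X₀ W (grade ℕ v) := by
  have (v : P) : Fintype {u : P // u ⋖ v} := Fintype.ofFinite _
  induction ht : grade ℕ v generalizing v with
  | zero => exact (X_of_rank_zero α ε X₀ W v ht).symm ▸ Submodule.subset_span (Set.mem_insert X₀ _)
  | succ t ih =>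
    rw [X_eq_smul_sum α ε X₀ W (ht ▸ t.succ_pos)]
    refine Submodule.smul_mem _ _ <| Submodule.sum_mem _ fun u _ =>
      Submodule.add_mem _ ?_ <| Submodule.smul_mem _ _ <| Submodule.subset_span ?_
    · exact inputSpan_mono X₀ W t.le_succ (ih u.1 (grade_of_covBy u.2 ht))
    · exact Set.mem_insert_of_mem _ (Set.mem_image_of_mem W ht.le)

theorem estimator_mem_inputSpan {t : ℕ} {c : P →₀ ℝ}
    (hc : c ∈ Finsupp.supported ℝ ℝ (layer P t)) : estimator α ε X₀ W c ∈ inputSpan X₀ W t :=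
  Submodule.sum_mem _ fun v hv => Submodule.smul_mem _ _ <|
    inputSpan_mono X₀ W (le_of_eq (hc hv)) (X_mem_inputSpan α ε X₀ W v)

end Finite

section Moments

variable [∀ v : P, Fintype {u : P // u ⋖ v}] {X₀ W} {μ₀ : ℝ} {σ₀sq : ℝ≥0} [IsProbabilityMeasure μ]

theorem IsInput.covariance_noise_of_mem_inputSpan (h : IsInput μ₀ σ₀sq X₀ W μ) {t : ℕ}
    {Y : Ω → ℝ} (hY : Y ∈ inputSpan X₀ W t) {c : P →₀ ℝ}
    (hc : c ∈ Finsupp.supported ℝ ℝ (layer P (t + 1))) : cov[Y, noise α W c; μ] = 0 := by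
  have hY_memLp := h.memLp_of_mem_inputSpan hY
  have noise_eq : noise α W c = ∑ v ∈ c.support, c v • vertexNoise α W v := rfl
  rw [noise_eq, covariance_sum_right' (fun v _ => (h.memLp_vertexNoise v).const_smul _) hY_memLp]
  refine Finset.sum_eq_zero fun v hv => ?_
  rw [covariance_smul_right, vertexNoise, covariance_smul_right,
    covariance_sum_right (fun _ => h.memLp_W _) hY_memLp, Finset.sum_eq_zero, mul_zero, mul_zero]
  exact fun u _ => h.covariance_W_of_mem_inputSpan hY (t.lt_succ_self.trans_eq (Eq.symm (hc hv)))

theorem IsInput.covariance_estimator_X₀ (h : IsInput μ₀ σ₀sq X₀ W μ) {t : ℕ} {c : P →₀ ℝ}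
    (hc : c ∈ Finsupp.supported ℝ ℝ (layer P t)) :
    cov[estimator α ε X₀ W c, X₀; μ] = ((descend α ^ t) c).degree * σ₀sq := by
  induction t generalizing c with
  | zero =>
    rw [estimator_of_layer_zero α ε X₀ W hc, covariance_smul_left,
      covariance_self h.law_X₀.aemeasurable, h.variance_X₀, pow_zero, Module.End.one_apply]
  | succ t ih =>
    have hdescend := descend_mem_supported α hc
    have hX₀ : X₀ ∈ inputSpan X₀ W t := Submodule.subset_span (Set.mem_insert _ _)
    rw [estimator_eq_add α ε X₀ W hc, covariance_add_left
      (h.memLp_of_mem_inputSpan (estimator_mem_inputSpan α ε X₀ W hdescend))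
      ((h.memLp_noise c).const_smul ε) h.memLp_X₀, covariance_smul_left,
      covariance_comm (noise α W c), h.covariance_noise_of_mem_inputSpan α hX₀ hc, mul_zero,
      add_zero, ih hdescend, pow_succ, Module.End.mul_apply]

theorem IsInput.variance_estimator (h : IsInput μ₀ σ₀sq X₀ W μ) {t : ℕ} {c : P →₀ ℝ}
    (hc : c ∈ Finsupp.supported ℝ ℝ (layer P t)) :
    Var[estimator α ε X₀ W c; μ] = ((descend α ^ t) c).degree ^ 2 * σ₀sq +
      ε ^ 2 * ∑ k ∈ Finset.range t, noisePower α ((descend α ^ k) c) := by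
  induction t generalizing c with
  | zero =>
    rw [estimator_of_layer_zero α ε X₀ W hc, variance_smul, h.variance_X₀, Finset.sum_range_zero,
      mul_zero, add_zero, pow_zero, Module.End.one_apply]
  | succ t ih =>
    have hdescend := descend_mem_supported α hc
    have hmem := estimator_mem_inputSpan α ε X₀ W hdescend
    rw [estimator_eq_add α ε X₀ W hc, variance_add (h.memLp_of_mem_inputSpan hmem)
      ((h.memLp_noise c).const_smul ε), covariance_smul_right,
      h.covariance_noise_of_mem_inputSpan α hmem hc, ih hdescend, variance_smul, h.variance_noise,
      Finset.sum_range_succ']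
    simp only [pow_succ, Module.End.mul_apply, pow_zero, Module.End.one_apply]
    ring

end Moments

end Model

section Grid

variable {d : ℕ} {P : Set (Fin (d + 1) → ℤ)}

theorem finite_window (N : ℕ) (x : Fin (d + 1) → ℤ) : (window P N x).Finite := by
  refine ((Set.finite_Icc x (x + N)).preimage Subtype.val_injective.injOn).subset fun u hu => ?_
  exact ⟨fun i => (hu i).1, fun i => (hu i).2.le⟩

theorem abs_sub_le_of_mem_window {N : ℕ} {x : Fin (d + 1) → ℤ} {u v : P} (hu : u ∈ window P N x)
    (hv : v ∈ window P N x) (i : Fin (d + 1)) : |u.1 i - v.1 i| ≤ N := by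
  obtain ⟨hu₁, hu₂⟩ := hu i
  obtain ⟨hv₁, hv₂⟩ := hv i
  rw [abs_le]
  lia

variable [GradeMinOrder ℕ P] {Ω : Type*} {mΩ : MeasurableSpace Ω} {μ : Measure Ω}
  (α : ℕ → ℝ) (ε : ℝ) (X₀ : Ω → ℝ) (W : CoverPair P → Ω → ℝ)

theorem exists_zeta_eq_estimator_of_window {c : P → ℝ} {t N : ℕ} {x : Fin (d + 1) → ℤ}
    (hc : ∀ u ∈ layer P t, c u ≠ 0 → u ∈ window P N x) :
    ∃ a ∈ Finsupp.supported ℝ ℝ (layer P t), (∀ u ∈ a.support, u ∈ window P N x) ∧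
      zeta α ε X₀ W c t = estimator α ε X₀ W a := by
  obtain ⟨a, ha, hac, hzeta⟩ := exists_zeta_eq_estimator α ε X₀ W
    ((finite_window N x).subset fun u hu => hc u hu.1 hu.2)
  exact ⟨a, ha, fun u hu => hc u (ha hu) (hac u hu), hzeta⟩

theorem singleVertexReconstruction_of_not_tendsto {v : ℕ → P} (hv : ∀ t, v t ∈ layer P t)
    (hpos : ∀ t, 0 < Var[X α ε X₀ W (v t); μ])
    (hcorr : ¬Tendsto (fun t => corr (X α ε X₀ W (v t)) X₀ μ) atTop (𝓝 0)) :
    SingleVertexReconstruction α ε X₀ W μ := by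
  refine ⟨fun t => (v t).1, (Set.range v).indicator 1, fun t u hu hcu => ?_, ?_, ?_⟩
  · obtain ⟨s, rfl⟩ := Set.mem_of_indicator_ne_zero hcu
    obtain rfl : s = t := (hv s).symm.trans hu
    exact fun i => ⟨le_rfl, lt_add_one _⟩
  · simpa only [zeta_indicator_range α ε X₀ W hv] using hpos
  · simpa only [zeta_indicator_range α ε X₀ W hv] using hcorr

end Grid

section Correlation

variable {Ω : Type*} {mΩ : MeasurableSpace Ω} {μ : Measure Ω} {Y Z T : Ω → ℝ}

theorem abs_corr_le_sqrt_mul {m M : ℝ} (hcov : cov[Y, T; μ] = m * cov[Z, T; μ])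
    (hvar : m ^ 2 * Var[Z; μ] ≤ M * Var[Y; μ]) (hZ : 0 < Var[Z; μ]) :
    |corr Y T μ| ≤ √M * |corr Z T μ| := by
  have abs_corr_eq (U : Ω → ℝ) : |corr U T μ| = |cov[U, T; μ]| / √Var[T; μ] / √Var[U; μ] := by
    rw [corr, Real.sqrt_mul (variance_nonneg U μ), abs_div, abs_mul,
      abs_of_nonneg (Real.sqrt_nonneg _), abs_of_nonneg (Real.sqrt_nonneg _),
      div_mul_eq_div_div_swap]
  have div_le_div : |m| / √Var[Y; μ] ≤ √M / √Var[Z; μ] := by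
    refine div_le_of_le_mul₀ (Real.sqrt_nonneg _) (by positivity) ?_
    rw [div_mul_eq_mul_div, le_div_iff₀ (Real.sqrt_pos.2 hZ), ← Real.sqrt_sq_eq_abs,
      ← Real.sqrt_mul (sq_nonneg m), ← Real.sqrt_mul' M (variance_nonneg Y μ)]
    exact Real.sqrt_le_sqrt hvar
  calc |corr Y T μ| = |m| / √Var[Y; μ] * (|cov[Z, T; μ]| / √Var[T; μ]) := by
        rw [abs_corr_eq, hcov, abs_mul]
        ring
    _ ≤ √M / √Var[Z; μ] * (|cov[Z, T; μ]| / √Var[T; μ]) := by gcongr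
    _ = √M * |corr Z T μ| := by
        rw [abs_corr_eq]
        ring

end Correlation

section HalfSpace

open AddMonoidAlgebra hiding grade

variable {d : ℕ}

theorem mem_layer_HS_iff {t : ℕ} {v : HS d} : v ∈ layer (HS d) t ↔ ∑ i, v.1 i = t := by
  rw [← HS_grade, Nat.cast_inj]
  rfl

theorem layer_HS_nonempty (t : ℕ) : (layer (HS d) t).Nonempty := by
  have sum_eq : ∑ i, (Pi.single 0 (t : ℤ) : Fin (d + 1) → ℤ) i = t :=
    Finset.sum_pi_single' 0 (t : ℤ) Finset.univ |>.trans (if_pos (Finset.mem_univ _))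
  exact ⟨⟨_, t.cast_nonneg.trans_eq sum_eq.symm⟩, mem_layer_HS_iff.2 sum_eq⟩

section LowerCovers

instance finite_covBy (v : HS d) : Finite {u : HS d // u ⋖ v} :=
  Set.Finite.subset ((Set.finite_range fun i => v.1 - Pi.single i 1).preimage
    Subtype.val_injective.injOn) fun u hu => (HS_covBy_iff u v).1 hu |>.imp fun _ => Eq.symm

noncomputable instance fintypeCovBy (v : HS d) : Fintype {u : HS d // u ⋖ v} := Fintype.ofFinite _

variable {t : ℕ} {v : HS d}

theorem card_covBy (hv : v ∈ layer (HS d) (t + 1)) :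
    Fintype.card {u : HS d // u ⋖ v} = d + 1 := by
  have h1 : 1 ≤ ∑ i, v.1 i := by rw [mem_layer_HS_iff.1 hv]; lia
  exact Nat.card_eq_fintype_card.symm.trans
    ((Nat.card_coe_set_eq {u : HS d | u ⋖ v}).trans (HS_ncard_covered v h1))

theorem sum_covBy {M : Type*} [AddCommMonoid M] (hv : v ∈ layer (HS d) (t + 1))
    (f : (Fin (d + 1) → ℤ) → M) :
    ∑ u : {u : HS d // u ⋖ v}, f u.1.1 = ∑ i, f (v.1 - Pi.single i 1) := by
  have mem_HS (i : Fin (d + 1)) : v.1 - Pi.single i 1 ∈ HS d := by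
    have hsum := HS_sum_sub_single v.1 i
    rw [mem_layer_HS_iff.1 hv] at hsum
    simp only [HS, Set.mem_ofPred_eq]
    lia
  let lower (i : Fin (d + 1)) : {u : HS d // u ⋖ v} :=
    ⟨⟨_, mem_HS i⟩, (HS_covBy_iff _ v).2 ⟨i, rfl⟩⟩
  have lower_surjective : Function.Surjective lower := fun ⟨u, hu⟩ =>
    ((HS_covBy_iff u v).1 hu).imp fun i hi => Subtype.ext (Subtype.ext hi.symm)
  have lower_bijective : Function.Bijective lower :=
    (Fintype.bijective_iff_surjective_and_card _).2
      ⟨lower_surjective, by rw [card_covBy hv, Fintype.card_fin]⟩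
  exact (lower_bijective.sum_comp fun u => f u.1.1).symm

end LowerCovers

/-- The steps of the random walk that moves from each vertex to a uniformly random vertex that it
covers. -/
def downStep (d : ℕ) : Fin (d + 1) → Fin (d + 1) → ℤ := fun i => -Pi.single i 1

theorem mem_closure_downStep_sub {z : Fin (d + 1) → ℤ} (hz : ∑ i, z i = 0) :
    z ∈ AddSubgroup.closure
      (Set.range fun p : Fin (d + 1) × Fin (d + 1) => downStep d p.1 - downStep d p.2) := by
  have eq_sum : z = ∑ i, z i • (downStep d 0 - downStep d i) := by
    simp only [smul_sub, Finset.sum_sub_distrib, ← Finset.sum_smul, hz]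
    ext j
    simp [downStep, Finset.sum_apply, Pi.single_apply]
  rw [eq_sum]
  exact sum_mem fun i _ => zsmul_mem (AddSubgroup.subset_closure (Set.mem_range_self (0, i))) _

/-- The coefficients of a linear combination of the `X v`, as an element of the group algebra of
the lattice. -/
noncomputable def toGroupAlgebra : (HS d →₀ ℝ) →ₗ[ℝ] ℝ[Fin (d + 1) → ℤ] :=
  (coeffLinearEquiv ℝ).symm.toLinearMap ∘ₗ Finsupp.lmapDomain ℝ ℝ Subtype.val

theorem toGroupAlgebra_single (v : HS d) (r : ℝ) :
    toGroupAlgebra (Finsupp.single v r) = single v.1 r :=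
  congrArg ofCoeff Finsupp.mapDomain_single

theorem exists_of_mem_support_toGroupAlgebra {c : HS d →₀ ℝ} {u : Fin (d + 1) → ℤ}
    (hu : u ∈ (toGroupAlgebra c).coeff.support) : ∃ v ∈ c.support, v.1 = u := by
  classical exact Finset.mem_image.1 (Finsupp.mapDomain_support hu)

theorem degree_coeff_toGroupAlgebra (c : HS d →₀ ℝ) :
    (toGroupAlgebra c).coeff.degree = c.degree :=
  Finsupp.degree_mapDomain _ c

theorem norm_toL2_toGroupAlgebra_sq (c : HS d →₀ ℝ) :
    ‖toL2 (toGroupAlgebra c)‖ ^ 2 = c.sum fun _ r => r ^ 2 := by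
  rw [norm_toL2_sq_eq_sum]
  exact Finsupp.sum_mapDomain_index_inj (h := fun _ r => r ^ 2) Subtype.val_injective

variable (α : ℕ → ℝ)

/-- The factor that a constant signal gains from one layer of the half-space to the next one. -/
def gain (α : ℕ → ℝ) (d : ℕ) : ℝ := α (d + 1) * (d + 1)

theorem noisePower_HS {t : ℕ} {c : HS d →₀ ℝ}
    (hc : c ∈ Finsupp.supported ℝ ℝ (layer (HS d) (t + 1))) :
    noisePower α c = α (d + 1) ^ 2 * (d + 1) * ‖toL2 (toGroupAlgebra c)‖ ^ 2 := by
  rw [noisePower, norm_toL2_toGroupAlgebra_sq, Finsupp.sum, Finsupp.sum, Finset.mul_sum]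
  refine Finset.sum_congr rfl fun v hv => ?_
  rw [card_covBy (hc hv)]
  push_cast
  ring

theorem toGroupAlgebra_descend {t : ℕ} {c : HS d →₀ ℝ}
    (hc : c ∈ Finsupp.supported ℝ ℝ (layer (HS d) (t + 1))) :
    toGroupAlgebra (descend α c) = gain α d • (stepLaw (downStep d) * toGroupAlgebra c) := by
  rw [Finsupp.supported_eq_span_single] at hc
  refine LinearMap.eqOn_span (f := toGroupAlgebra ∘ₗ descend α)
    (g := gain α d • LinearMap.mulLeft ℝ (stepLaw (downStep d)) ∘ₗ toGroupAlgebra)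
    ?_ hc
  rintro _ ⟨v, hv, rfl⟩
  have card_smul := sum_single_eq_card_smul_stepLaw (downStep d)
  rw [Fintype.card_fin, Nat.cast_add_one] at card_smul
  simp only [descend, LinearMap.comp_apply, LinearMap.smul_apply, LinearMap.mulLeft_apply,
    Finsupp.linearCombination_single, one_smul, map_smul, map_sum, toGroupAlgebra_single,
    card_covBy hv, sum_covBy hv (single · (1 : ℝ))]
  rw [gain, mul_smul, ← smul_mul_assoc, ← card_smul, Finset.sum_mul]
  simp only [single_mul_single, downStep, neg_add_eq_sub, mul_one]

theorem degree_descend {t : ℕ} {c : HS d →₀ ℝ}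
    (hc : c ∈ Finsupp.supported ℝ ℝ (layer (HS d) (t + 1))) :
    (descend α c).degree = gain α d * c.degree := by
  have degree_smul (r : ℝ) (a : HS d →₀ ℝ) : (r • a).degree = r * a.degree :=
    (Finsupp.sum_smul_index (h := fun _ x => x) fun _ => rfl).trans (Finsupp.mul_sum r a).symm
  rw [descend, Finsupp.linearCombination_apply, Finsupp.sum, map_sum, Finsupp.degree_apply,
    Finset.mul_sum]
  refine Finset.sum_congr rfl fun v hv => ?_
  simp only [degree_smul, map_sum, Finsupp.degree_single, Finset.sum_const, Finset.card_univ,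
    card_covBy (hc hv), nsmul_one, gain]
  push_cast
  ring

theorem toGroupAlgebra_descend_pow {k t : ℕ} {c : HS d →₀ ℝ}
    (hc : c ∈ Finsupp.supported ℝ ℝ (layer (HS d) (t + k))) :
    toGroupAlgebra ((descend α ^ k) c) =
      gain α d ^ k • (stepLaw (downStep d) ^ k * toGroupAlgebra c) := by
  induction k generalizing t with
  | zero => simp
  | succ k ih =>
    have hc' : c ∈ Finsupp.supported ℝ ℝ (layer (HS d) (t + 1 + k)) := by
      rwa [add_assoc, add_comm 1]
    rw [pow_succ', Module.End.mul_apply,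
      toGroupAlgebra_descend α (descend_pow_mem_supported α hc'), ih hc', mul_smul_comm, smul_smul,
      ← pow_succ', ← mul_assoc, ← pow_succ']

theorem degree_descend_pow {t : ℕ} {c : HS d →₀ ℝ}
    (hc : c ∈ Finsupp.supported ℝ ℝ (layer (HS d) t)) :
    ((descend α ^ t) c).degree = gain α d ^ t * c.degree := by
  induction t generalizing c with
  | zero => simp
  | succ t ih =>
    rw [pow_succ, Module.End.mul_apply, ih (descend_mem_supported α hc), degree_descend α hc,
      pow_succ, mul_assoc]

theorem noisePower_descend_pow {k t : ℕ} {c : HS d →₀ ℝ}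
    (hc : c ∈ Finsupp.supported ℝ ℝ (layer (HS d) t)) (hk : k < t) :
    noisePower α ((descend α ^ k) c) = α (d + 1) ^ 2 * (d + 1) *
      ((gain α d ^ 2) ^ k * ‖toL2 (stepLaw (downStep d) ^ k * toGroupAlgebra c)‖ ^ 2) := by
  obtain ⟨s, rfl⟩ := Nat.exists_eq_add_of_lt hk
  have hc' : c ∈ Finsupp.supported ℝ ℝ (layer (HS d) (s + 1 + k)) := by
    rwa [add_comm (s + 1), ← add_assoc]
  rw [noisePower_HS α (descend_pow_mem_supported α hc'), toGroupAlgebra_descend_pow α hc',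
    map_smul, norm_smul, mul_pow, Real.norm_eq_abs, sq_abs, pow_right_comm]

section Moments

variable {α} {Ω : Type*} {mΩ : MeasurableSpace Ω} {μ : Measure Ω} [IsProbabilityMeasure μ]
  {μ₀ : ℝ} {σ₀sq : ℝ≥0} {X₀ : Ω → ℝ} {W : CoverPair (HS d) → Ω → ℝ} (ε : ℝ)

theorem IsInput.covariance_estimator_HS (h : IsInput μ₀ σ₀sq X₀ W μ) {t : ℕ} {c : HS d →₀ ℝ}
    (hc : c ∈ Finsupp.supported ℝ ℝ (layer (HS d) t)) :
    cov[estimator α ε X₀ W c, X₀; μ] = c.degree * (gain α d ^ t * σ₀sq) := by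
  rw [h.covariance_estimator_X₀ α ε hc, degree_descend_pow α hc]
  ring

theorem IsInput.variance_estimator_HS (h : IsInput μ₀ σ₀sq X₀ W μ) {t : ℕ} {c : HS d →₀ ℝ}
    (hc : c ∈ Finsupp.supported ℝ ℝ (layer (HS d) t)) :
    Var[estimator α ε X₀ W c; μ] =
      c.degree ^ 2 * ((gain α d ^ 2) ^ t * σ₀sq) +
        ε ^ 2 * (α (d + 1) ^ 2 * (d + 1)) * ∑ k ∈ Finset.range t,
          (gain α d ^ 2) ^ k * ‖toL2 (stepLaw (downStep d) ^ k * toGroupAlgebra c)‖ ^ 2 := by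
  rw [h.variance_estimator α ε hc, degree_descend_pow α hc, Finset.sum_congr rfl fun k hk =>
    noisePower_descend_pow α hc (Finset.mem_range.1 hk), ← Finset.mul_sum]
  ring

theorem IsInput.covariance_X_HS (h : IsInput μ₀ σ₀sq X₀ W μ) {t : ℕ} {v : HS d}
    (hv : v ∈ layer (HS d) t) :
    cov[X α ε X₀ W v, X₀; μ] = gain α d ^ t * σ₀sq := by
  have hcov := h.covariance_estimator_HS (α := α) ε (Finsupp.single_mem_supported ℝ 1 hv)
  rwa [estimator_single, Finsupp.degree_single, one_mul] at hcov

theorem IsInput.variance_X_HS (h : IsInput μ₀ σ₀sq X₀ W μ) {t : ℕ} {v : HS d}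
    (hv : v ∈ layer (HS d) t) :
    Var[X α ε X₀ W v; μ] = (gain α d ^ 2) ^ t * σ₀sq +
      ε ^ 2 * (α (d + 1) ^ 2 * (d + 1)) * ∑ k ∈ Finset.range t,
        (gain α d ^ 2) ^ k * ‖toL2 (stepLaw (downStep d) ^ k)‖ ^ 2 := by
  have hvar := h.variance_estimator_HS (α := α) ε (Finsupp.single_mem_supported ℝ 1 hv)
  simpa only [estimator_single, Finsupp.degree_single, one_pow, one_mul, toGroupAlgebra_single,
    mul_comm _ (single _ _), norm_toL2_single_mul] using hvar

theorem IsInput.variance_X_HS_pos (h : IsInput μ₀ σ₀sq X₀ W μ) (hσ₀ : 0 < σ₀sq)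
    (hgain : gain α d ≠ 0) (v : HS d) : 0 < Var[X α ε X₀ W v; μ] := by
  rw [h.variance_X_HS ε (v := v) rfl]
  positivity

theorem IsInput.gain_ne_zero_of_variance_pos (h : IsInput μ₀ σ₀sq X₀ W μ) {t : ℕ} {c : HS d →₀ ℝ}
    (hc : c ∈ Finsupp.supported ℝ ℝ (layer (HS d) (t + 1)))
    (hpos : 0 < Var[estimator α ε X₀ W c; μ]) : gain α d ≠ 0 := by
  intro hgain
  have hα : α (d + 1) = 0 := (mul_eq_zero.1 hgain).resolve_right d.cast_add_one_ne_zero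
  simp [h.variance_estimator_HS ε hc, hgain, hα] at hpos

theorem IsInput.exists_degree_sq_mul_variance_X_le (h : IsInput μ₀ σ₀sq X₀ W μ) (hσ₀ : 0 < σ₀sq)
    (N : ℕ) :
    ∃ M : ℝ, ∀ {t : ℕ} {c : HS d →₀ ℝ} {x : Fin (d + 1) → ℤ} {v : HS d},
      c ∈ Finsupp.supported ℝ ℝ (layer (HS d) t) → (∀ u ∈ c.support, u ∈ window (HS d) N x) →
      v ∈ layer (HS d) t →
      c.degree ^ 2 * Var[X α ε X₀ W v; μ] ≤ M * Var[estimator α ε X₀ W c; μ] := by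
  classical
  let B : Finset (Fin (d + 1) → ℤ) :=
    (Finset.Icc (fun _ => -(N : ℤ)) fun _ => (N : ℤ)).filter fun z => ∑ i, z i = 0
  obtain ⟨M, hM⟩ := exists_degree_sq_mul_add_sum_le (downStep d) (B := B)
    (fun z hz => mem_closure_downStep_sub (Finset.mem_filter.1 hz).2) (sq_nonneg (gain α d))
    (κ := ε ^ 2 * (α (d + 1) ^ 2 * (d + 1))) (by positivity) (NNReal.coe_pos.2 hσ₀)
  refine ⟨M, fun {t c x v} hc hx hv => ?_⟩
  rw [h.variance_X_HS ε hv, h.variance_estimator_HS ε hc, ← degree_coeff_toGroupAlgebra]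
  refine hM _ (fun u' hu' w' hw' => ?_) t
  obtain ⟨u, hu, rfl⟩ := exists_of_mem_support_toGroupAlgebra hu'
  obtain ⟨w, hw, rfl⟩ := exists_of_mem_support_toGroupAlgebra hw'
  have abs_le_N (i : Fin (d + 1)) := abs_le.1 (abs_sub_le_of_mem_window (hx u hu) (hx w hw) i)
  refine Finset.mem_filter.2
    ⟨Finset.mem_Icc.2 ⟨fun i => (abs_le_N i).1, fun i => (abs_le_N i).2⟩, ?_⟩
  simp only [Pi.sub_apply, Finset.sum_sub_distrib, mem_layer_HS_iff.1 (hc hu),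
    mem_layer_HS_iff.1 (hc hw), sub_self]

theorem IsInput.exists_abs_corr_zeta_le (h : IsInput μ₀ σ₀sq X₀ W μ) (hσ₀ : 0 < σ₀sq)
    (hgain : gain α d ≠ 0) (N : ℕ) :
    ∃ K : ℝ, ∀ {t : ℕ} {c : HS d → ℝ} {x : Fin (d + 1) → ℤ} {v : HS d},
      (∀ u ∈ layer (HS d) t, c u ≠ 0 → u ∈ window (HS d) N x) → v ∈ layer (HS d) t →
      |corr (zeta α ε X₀ W c t) X₀ μ| ≤ K * |corr (X α ε X₀ W v) X₀ μ| := by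
  obtain ⟨M, hM⟩ := h.exists_degree_sq_mul_variance_X_le (α := α) ε hσ₀ N
  refine ⟨√M, fun {t c x v} hx hv => ?_⟩
  obtain ⟨a, ha, hax, hzeta⟩ := exists_zeta_eq_estimator_of_window α ε X₀ W hx
  rw [hzeta]
  refine abs_corr_le_sqrt_mul (m := a.degree) ?_ (hM ha hax hv) (h.variance_X_HS_pos ε hσ₀ hgain v)
  rw [h.covariance_estimator_HS ε ha, h.covariance_X_HS ε hv]

end Moments

end HalfSpace

end Reconstruction

theorem mainTheorem5_general (d : ℕ) (α : ℕ → ℝ) (ε : ℝ) (μ₀ : ℝ) (σ₀sq : ℝ≥0) (hσ₀ : 0 < σ₀sq)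
    {Ω : Type*} [MeasurableSpace Ω] (μ : Measure Ω) [IsProbabilityMeasure μ]
    (X₀ : Ω → ℝ) (W : Reconstruction.CoverPair (Reconstruction.HS d) → Ω → ℝ)
    (hXW : Reconstruction.IsInput μ₀ σ₀sq X₀ W μ) :
    Reconstruction.LocalReconstruction α ε X₀ W μ ↔
      Reconstruction.SingleVertexReconstruction α ε X₀ W μ := by
  open Reconstruction in
  refine ⟨fun ⟨N, x, c, hwindow, hvar, hcorr⟩ => ?_, fun h => ⟨1, h⟩⟩
  have hgain : gain α d ≠ 0 := by
    obtain ⟨a, ha, -, hzeta⟩ := exists_zeta_eq_estimator_of_window α ε X₀ W (hwindow 1)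
    exact hXW.gain_ne_zero_of_variance_pos ε ha (hzeta ▸ hvar 1)
  obtain ⟨K, hK⟩ := hXW.exists_abs_corr_zeta_le ε hσ₀ hgain N
  choose v hv using layer_HS_nonempty (d := d)
  refine singleVertexReconstruction_of_not_tendsto α ε X₀ W hv
    (fun t => hXW.variance_X_HS_pos ε hσ₀ hgain (v t)) fun hvertex => hcorr ?_
  refine squeeze_zero_norm (fun t => hK (hwindow t) (hv t)) ?_
  simpa using hvertex.abs.const_mul K

theorem mainTheorem5 (d : ℕ) (α : ℕ → ℝ) (hα : ∀ i, 1 ≤ i → i ≤ d + 1 → 0 < α i)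
    (ε : ℝ) (hε : 0 < ε) (μ₀ : ℝ) (σ₀sq : ℝ≥0) (hσ₀ : 0 < σ₀sq)
    {Ω : Type*} [MeasurableSpace Ω] (μ : Measure Ω) [IsProbabilityMeasure μ]
    (X₀ : Ω → ℝ) (W : Reconstruction.CoverPair (Reconstruction.HS d) → Ω → ℝ)
    (hXW : Reconstruction.IsInput μ₀ σ₀sq X₀ W μ) :
    Reconstruction.LocalReconstruction α ε X₀ W μ ↔
      Reconstruction.SingleVertexReconstruction α ε X₀ W μ :=
  mainTheorem5_general d α ε μ₀ σ₀sq hσ₀ μ X₀ W hXW
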